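/- An \emph{algebraic manifold} is a smooth separated scheme of finite type over $\mathbb{C}$ (equivalently, a smooth complex algebraic variety, not necessarily connected); points are complex points and regular maps are morphisms over $\mathbb{C}$. For a regular map $s:X\to Y$ of algebraic manifolds, $\operatorname{Sing}(s)\subset X$ is the set of points at which $s$ is not a submersion, i.e. at which the differential of $s$ is not surjective; $\dim\emptyset=-\infty$. A \emph{one-parameter unipotent subgroup} of $\operatorname{Aut}X$ is an algebraic action $\sigma:X\times\mathbb{C}\to X$ of the additive group $(\mathbb{C},+)$. A quasi-affine algebraic manifold $X$ is \emph{flexible} if for every $x\in X$ the tangent space $T_xX$ is spanned by the tangent vectors at $x$ to the orbits through $x$ of one-parameter unipotent subgroups of $\operatorname{Aut}X$. An algebraic manifold is \emph{locally flexible} if it is covered by flexible Zariski open subsets. A regular map $s:U\times\mathbb{C}^N\to Y$ is a \emph{dominating algebraic spray} over a regular map $f:U\to Y$ if, for every $y\in U$, $s(y,0)=f(y)$ and $s(y,\cdot):\mathbb{C}^N\to Y$ is a submersion at $0$. \textbf{Proposition.} Let $Y$ be an algebraic manifold. (1) If $Y$ is locally flexible, then every $y_0\in Y$ has a Zariski open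 neighborhood $U\subset Y$ for which there exist $N\ge 0$ and a regular map $s:U\times\mathbb{C}^N\to Y$ such that $\dim\operatorname{Sing}(s)<N$ and, for each $y\in U$, $s(y,0)=y$ and $s(y,\cdot):\mathbb{C}^N\to Y$ is a submersion at $0$. (2) For every flexible Zariski open subset $U\subset Y$ there exist $N\ge 0$ and one-parameter unipotent subgroups $\sigma_1,\dots,\sigma_N$ of $\operatorname{Aut}U$ such that the regular map $$s:U\times\mathbb{C}^N\to U,\qquad s(y,t_1,\dots,t_N)=\sigma_N\bigl(\cdots\sigma_2(\sigma_1(y,t_1),t_2)\cdots,t_N\bigr)$$ is a dominating algebraic spray over $\mathrm{id}_U$, satisfies $s(\cdot,w)\in\operatorname{Aut}U$ for every $w\in\mathbb{C}^N$, and has $\operatorname{Sing}(s)=\emptyset$. Composed with the inclusion $U\hookrightarrow Y$, it is a dominating algebraic spray over this inclusion whose singular locus is empty. -/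

import Mathlib

open CategoryTheory AlgebraicGeometry

namespace CAlg

noncomputable section

/-- The spectrum of the field of complex numbers. -/
abbrev SpecC : Scheme.{0} := Spec (CommRingCat.of ℂ)

/-- Schemes over `ℂ`; the morphisms of this category are the morphisms over `Spec ℂ`
(for varieties: the regular maps). -/
abbrev CSch := Over SpecC

/-- The one-point variety `Spec ℂ`. -/
abbrev pointC : CSch := Over.mk (𝟙 SpecC)

/-- An algebraic manifold: a smooth separated scheme of finite type over `ℂ`
(not necessarily connected or equidimensional). -/
structure IsAlgebraicManifold (X : CSch) : Prop where
  smooth : Smooth X.hom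
  separated : IsSeparated X.hom
  quasiCompact : QuasiCompact X.hom

/-- The open subscheme on a Zariski open subset, as a scheme over `ℂ`. -/
abbrev opn (X : CSch) (U : X.left.Opens) : CSch := Over.mk (U.ι ≫ X.hom)

/-- The inclusion `U ↪ X` of a Zariski open subset. -/
def incl (X : CSch) (U : X.left.Opens) : opn X U ⟶ X := Over.homMk U.ι

/-! ### Complex points and tangent spaces -/

/-- Points of a complex variety in the classical sense: morphisms `Spec ℂ ⟶ X` over `Spec ℂ`. -/
abbrev CPoint (X : CSch) := pointC ⟶ X

/-- The point of the underlying topological space given by a complex point. -/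
def CPoint.pt {X : CSch} (x : CPoint X) : X.left := x.left (IsLocalRing.closedPoint ℂ)

/-- The local ring of `X` at a complex point. -/
abbrev CPoint.localRing {X : CSch} (x : CPoint X) : CommRingCat := X.left.presheaf.stalk x.pt

/-- Evaluation of germs at a complex point. -/
def CPoint.eval {X : CSch} (x : CPoint X) : x.localRing →+* ℂ :=
  (Scheme.stalkClosedPointTo (R := CommRingCat.of ℂ) x.left).hom

/-- The constant functions on a scheme over `ℂ`. -/
def const (X : CSch) : ℂ →+* Γ(X.left, ⊤) :=
  (X.hom.appTop).hom.comp (Scheme.ΓSpecIso (CommRingCat.of ℂ)).inv.hom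

instance {X : CSch} (x : CPoint X) : Algebra ℂ x.localRing :=
  ((X.left.presheaf.germ ⊤ x.pt trivial).hom.comp (const X)).toAlgebra

/-- `ℂ`, as a module over the local ring at `x` through evaluation at `x`. -/
def CPoint.ResField {X : CSch} (_x : CPoint X) : Type := ℂ

instance {X : CSch} (x : CPoint X) : AddCommGroup x.ResField :=
  inferInstanceAs (AddCommGroup ℂ)

instance {X : CSch} (x : CPoint X) : Module ℂ x.ResField :=
  inferInstanceAs (Module ℂ ℂ)

instance {X : CSch} (x : CPoint X) : Module x.localRing x.ResField :=
  Module.compHom ℂ x.eval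

instance {X : CSch} (x : CPoint X) : SMulCommClass ℂ x.localRing x.ResField :=
  ⟨fun a f (z : ℂ) => by
    change a * (x.eval f * z) = x.eval f * (a * z)
    ring⟩

/-- The (Zariski) tangent space of `X` at a complex point `x`: the `ℂ`-linear
derivations `D : 𝒪_{X,x} → ℂ`, `D (f * g) = f(x) * D g + g(x) * D f`. -/
abbrev TangentSp {X : CSch} (x : CPoint X) : Type :=
  Derivation ℂ x.localRing x.ResField

/-- Pullback of germs along a morphism. -/
def pullGerm {X Y : CSch} (f : X ⟶ Y) (x : CPoint X) :
    (CPoint.localRing (x ≫ f)) →+* x.localRing :=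
  (f.left.stalkMap x.pt).hom

theorem pullGerm_algebraMap {X Y : CSch} (f : X ⟶ Y) (x : CPoint X) (c : ℂ) :
    pullGerm f x (algebraMap ℂ (CPoint.localRing (x ≫ f)) c) = algebraMap ℂ x.localRing c := by
  have h1 : f.left.appTop (const Y c) = const X c := by
    have h : Y.hom.appTop ≫ f.left.appTop = X.hom.appTop := by
      rw [← Scheme.Hom.comp_appTop, Over.w f]
    exact congr($h ((Scheme.ΓSpecIso (CommRingCat.of ℂ)).inv c))
  have h2 := Scheme.Hom.germ_stalkMap_apply f.left ⊤ x.pt trivial (const Y c)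
  exact h2.trans (congrArg (fun g => X.left.presheaf.germ ⊤ x.pt trivial g) h1)

theorem eval_pullGerm {X Y : CSch} (f : X ⟶ Y) (x : CPoint X)
    (g : CPoint.localRing (x ≫ f)) :
    x.eval (pullGerm f x g) = CPoint.eval (x ≫ f) g := by
  have h := Scheme.stalkClosedPointTo_comp (R := CommRingCat.of ℂ) x.left f.left
  exact congr($h g).symm

/-- The differential `T_x X → T_{f(x)} Y` of a morphism `f` at a complex point `x`,
`D ↦ D ∘ f^*`. -/
def differential {X Y : CSch} (f : X ⟶ Y) (x : CPoint X) :
    TangentSp x →ₗ[ℂ] TangentSp (X := Y) (x ≫ f) where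
  toFun D := Derivation.mk'
    { toFun := fun g => (D (pullGerm f x g) : ℂ)
      map_add' := fun g h => by
        rw [map_add, map_add]; rfl
      map_smul' := fun c g => by
        rw [Algebra.smul_def, map_mul, pullGerm_algebraMap, ← Algebra.smul_def, D.map_smul]
        rfl }
    (fun g h => by
      have e (g : CPoint.localRing (x ≫ f)) (z : ℂ) :
          x.eval (pullGerm f x g) * z = CPoint.eval (x ≫ f) g * z := by rw [eval_pullGerm]
      exact ((congrArg D (map_mul (pullGerm f x) g h)).trans (D.leibniz _ _)).trans
        (congrArg₂ (fun a b : ℂ => a + b) (e g (D (pullGerm f x h))) (e h (D (pullGerm f x g)))))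
  map_add' _ _ := rfl
  map_smul' _ _ := rfl

/-- Transport of tangent spaces along an equality of points. -/
def tangentCongr {X : CSch} {x y : CPoint X} (h : x = y) : TangentSp x ≃ₗ[ℂ] TangentSp y :=
  h ▸ LinearEquiv.refl ℂ (TangentSp x)

/-- `f` is a submersion at the complex point `x`: its differential at `x` is surjective. -/
def IsSubmersionAt {X Y : CSch} (f : X ⟶ Y) (x : CPoint X) : Prop :=
  Function.Surjective (differential f x)

/-- The singular locus of a regular map: the set of points where it is not a submersion
(as a set of closed points of `X`). -/
def Sing {X Y : CSch} (f : X ⟶ Y) : Set X.left :=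
  {z | ∃ x : CPoint X, x.pt = z ∧ ¬ IsSubmersionAt f x}

/-! ### Products with affine spaces -/

/-- The product `X × ℂⁿ`, as a scheme over `ℂ`. -/
abbrev affProd (n : Type) (X : CSch) : CSch := Over.mk ((𝔸(n; X.left) ↘ X.left) ≫ X.hom)

/-- The projection `X × ℂⁿ ⟶ X`. -/
def proj (n : Type) (X : CSch) : affProd n X ⟶ X := Over.homMk (𝔸(n; X.left) ↘ X.left)

/-- The morphism `(u, t) : T ⟶ X × ℂⁿ` given by `u : T ⟶ X` and functions `tᵢ` on `T`. -/
def pairing {n : Type} {T X : CSch} (u : T ⟶ X) (t : n → Γ(T.left, ⊤)) : T ⟶ affProd n X :=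
  Over.homMk (AffineSpace.homOfVector u.left t) (by simp)

/-- The slice `X ⟶ X × ℂⁿ`, `x ↦ (x, w)`, for a vector `w ∈ ℂⁿ`. -/
def slice {n : Type} (X : CSch) (w : n → ℂ) : X ⟶ affProd n X :=
  pairing (𝟙 X) (fun i => const X (w i))

/-- The morphism `f × id : X × ℂⁿ ⟶ Y × ℂⁿ`. For a point `x : pointC ⟶ X` this is the inclusion
of the fibre `ℂⁿ ≅ {x} × ℂⁿ`. -/
def affMap (n : Type) {X Y : CSch} (f : X ⟶ Y) : affProd n X ⟶ affProd n Y :=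
  Over.homMk (AffineSpace.map n f.left) (by simp)

/-- The origin of `ℂⁿ`. -/
def origin (n : Type) : CPoint (affProd n pointC) := slice pointC 0

/-! ### Sprays -/

/-- `s : X × ℂⁿ ⟶ Y` is an algebraic spray over `f : X ⟶ Y` (on the trivial bundle):
`s(x, 0) = f(x)`. -/
def IsSpray {n : Type} {X Y : CSch} (f : X ⟶ Y) (s : affProd n X ⟶ Y) : Prop :=
  slice X 0 ≫ s = f

/-- `s : X × ℂⁿ ⟶ Y` is dominating: for every point `x` of `X`, the regular map
`s(x, ·) : ℂⁿ ⟶ Y` is a submersion at `0`. -/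
def IsDominating {n : Type} {X Y : CSch} (s : affProd n X ⟶ Y) : Prop :=
  ∀ x : CPoint X, IsSubmersionAt (affMap n x ≫ s) (origin n)

/-- Every point of `Y` has a Zariski open neighbourhood `U` with a regular map
`s : U × ℂᴺ ⟶ Y` such that `dim Sing(s) < N` and, for all `y ∈ U`, `s(y, 0) = y` and
`s(y, ·) : ℂᴺ ⟶ Y` is a submersion at `0`. (The dimension of the empty set is `-∞`.) -/
def HasLocalSpraysWithSmallSing (Y : CSch) : Prop :=
  ∀ y : Y.left, ∃ U : Y.left.Opens, y ∈ U ∧ ∃ (N : ℕ) (s : affProd (Fin N) (opn Y U) ⟶ Y),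
    topologicalKrullDim (Sing s) < N ∧ IsSpray (incl Y U) s ∧ IsDominating s

/-! ### Flexibility -/

/-- For `σ : X × ℂ ⟶ X`, a morphism `u : T ⟶ X` and a function `t` on `T`, the morphism
`T ⟶ X`, `p ↦ σ(u(p), t(p))`. -/
def act {T X : CSch} (σ : affProd Unit X ⟶ X) (u : T ⟶ X) (t : Γ(T.left, ⊤)) : T ⟶ X :=
  pairing u (fun _ => t) ≫ σ

/-- A one-parameter unipotent subgroup of `Aut X`: an algebraic action `X × ℂ ⟶ X` of the
additive group `(ℂ, +)` on `X` (the action axioms are stated on `T`-valued points). -/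
structure OneParamUnipotent (X : CSch) where
  map : affProd Unit X ⟶ X
  act_zero : ∀ {T : CSch} (u : T ⟶ X), act map u 0 = u
  act_add : ∀ {T : CSch} (u : T ⟶ X) (a b : Γ(T.left, ⊤)),
    act map u (a + b) = act map (act map u a) b

/-- The orbit map `ℂ ⟶ X`, `t ↦ σ(x, t)`. -/
def OneParamUnipotent.orbit {X : CSch} (σ : OneParamUnipotent X) (x : CPoint X) :
    affProd Unit pointC ⟶ X :=
  affMap Unit x ≫ σ.map

theorem origin_affMap (n : Type) {X : CSch} (x : CPoint X) :
    origin n ≫ affMap n x = x ≫ slice X 0 := by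
  ext : 1
  change AffineSpace.homOfVector _ _ ≫ AffineSpace.homOfVector _ _ =
    x.left ≫ AffineSpace.homOfVector _ _
  rw [AffineSpace.comp_homOfVector, AffineSpace.comp_homOfVector]
  congr 1
  · rw [AffineSpace.homOfVector_over_assoc]
    simp
  · funext i
    refine (AffineSpace.homOfVector_appTop_coord _ _ i).trans ?_
    simp

theorem OneParamUnipotent.origin_orbit {X : CSch} (σ : OneParamUnipotent X) (x : CPoint X) :
    origin Unit ≫ σ.orbit x = x := by
  have h : slice X 0 ≫ σ.map = 𝟙 X := by
    have := σ.act_zero (𝟙 X)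
    simpa [act, slice, Pi.zero_def] using this
  rw [OneParamUnipotent.orbit, ← Category.assoc, origin_affMap, Category.assoc, h,
    Category.comp_id]

/-- The tangent vectors at `x` to the orbits through `x` of one-parameter unipotent subgroups. -/
def orbitTangents {X : CSch} (x : CPoint X) : Set (TangentSp x) :=
  {v | ∃ (σ : OneParamUnipotent X) (ξ : TangentSp (origin Unit)),
    v = tangentCongr (σ.origin_orbit x) (differential (σ.orbit x) (origin Unit) ξ)}

/-- Flexible quasi-affine manifolds. -/
structure IsFlexible (X : CSch) : Prop where
  isAlgebraicManifold : IsAlgebraicManifold X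
  isQuasiAffine : X.left.IsQuasiAffine
  span_eq_top : ∀ x : CPoint X, Submodule.span ℂ (orbitTangents x) = ⊤

/-- Locally flexible manifolds: covered by flexible Zariski open subsets. -/
structure IsLocallyFlexible (Y : CSch) : Prop where
  isAlgebraicManifold : IsAlgebraicManifold Y
  cover : ∀ y : Y.left, ∃ U : Y.left.Opens, y ∈ U ∧ IsFlexible (opn Y U)

/-- The composed map `X × ℂᴺ ⟶ X`,
`(x, t₁, …, t_N) ↦ σ_N(… σ₂(σ₁(x, t₁), t₂) …, t_N)`. -/
def composedSpray {X : CSch} {N : ℕ} (σ : Fin N → OneParamUnipotent X) :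
    affProd (Fin N) X ⟶ X :=
  Fin.foldl N (fun u i => act (σ i).map u (AffineSpace.coord X.left i)) (proj (Fin N) X)

end

end CAlg

/-! Two facts about the composed flow s = `composedSpray σ` carry the proof.

For fixed w the map s(·, w) is a composite of automorphisms, and every complex point of X × ℂᴺ lies
on a slice X × {w}. The restriction of s to that slice is an isomorphism, so s is already a
submersion there. The singular locus is therefore empty for every choice of the subgroups σ_i
(`isSubmersionAt_composedSpray`).

On the i-th axis through (x, 0) all other times vanish and s is the orbit map of σ_i
(`axis_composedSpray`). By the chain rule the image of the differential of s(x, ·) at 0 contains the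
velocities of all σ_i at x. Domination thus reduces to finding finitely many subgroups whose
velocities span every tangent space.

Flexibility gives spanning at each point, and finite dimension makes finitely many subgroups enough
there. Two ingredients make spanning an open condition. First, the velocities of one subgroup form
an algebraic vector field: for a section f on an affine open set, x ↦ v_x(f) is again a section,
namely the ε-coefficient of f along the flow over the dual numbers (`exists_velocity_section`).
Second, a finite family of algebraic vector fields that spans at one point spans nearby, by Nakayama
for the Kähler differentials and a determinant (`exists_finset_pointDer_le_span`). Quasi-compactness
then leaves finitely many subgroups (`exists_finset_span_velocity`). -/

namespace CAlg

/-- The derivations `A → ℂ` at a `ℂ`-point `φ` of a `ℂ`-algebra `A`. -/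
def pointDer {A : Type*} [CommRing A] [Algebra ℂ A] (φ : A →ₐ[ℂ] ℂ) :
    Submodule ℂ (A →ₗ[ℂ] ℂ) where
  carrier := {d | ∀ a b, d (a * b) = φ a * d b + φ b * d a}
  add_mem' := fun {d e} hd he a b => by
    simp only [LinearMap.add_apply, hd a b, he a b]; ring
  zero_mem' := fun a b => by simp
  smul_mem' := fun c d hd a b => by
    simp only [LinearMap.smul_apply, hd a b, smul_eq_mul]; ring

/-! ### Derivations at a point of a finitely generated algebra, and openness of spanning. -/

section pointDer

variable {A : Type*} [CommRing A] [Algebra ℂ A]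

theorem mem_pointDer {φ : A →ₐ[ℂ] ℂ} {d : A →ₗ[ℂ] ℂ} :
    d ∈ pointDer φ ↔ ∀ a b, d (a * b) = φ a * d b + φ b * d a := Iff.rfl

theorem eq_zero_of_mem_pointDer {φ : A →ₐ[ℂ] ℂ} {d : A →ₗ[ℂ] ℂ} (hd : d ∈ pointDer φ)
    {S : Set A} (hS : Algebra.adjoin ℂ S = ⊤) (h : ∀ a ∈ S, d a = 0) : d = 0 := by
  have h1 : d 1 = 0 := by
    have := hd 1 1
    rw [map_one, mul_one, one_mul] at this
    linear_combination -this
  ext a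
  have ha : a ∈ Algebra.adjoin ℂ S := hS ▸ trivial
  induction ha using Algebra.adjoin_induction with
  | mem x hx => exact h x hx
  | algebraMap r => simp [Algebra.algebraMap_eq_smul_one, h1]
  | add x y _ _ hx hy => simpa using by rw [hx, hy]; simp
  | mul x y _ _ hx hy =>
    rw [hd x y, hx, hy]; simp

theorem finiteDimensional_pointDer [Algebra.FiniteType ℂ A] (φ : A →ₐ[ℂ] ℂ) :
    FiniteDimensional ℂ (pointDer φ) := by
  obtain ⟨S, hS⟩ := (‹Algebra.FiniteType ℂ A›).out
  let F : pointDer φ →ₗ[ℂ] (S → ℂ) :=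
    { toFun := fun d a => d.1 a
      map_add' := fun _ _ => rfl
      map_smul' := fun _ _ => rfl }
  refine FiniteDimensional.of_injective F ?_
  rw [← LinearMap.ker_eq_bot, LinearMap.ker_eq_bot']
  intro d hd
  exact Subtype.ext (eq_zero_of_mem_pointDer d.2 hS fun a ha => congrFun hd ⟨a, ha⟩)

/-- A derivation at a point factors through the Kähler differentials. -/
theorem exists_kaehler_of_mem_pointDer {φ : A →ₐ[ℂ] ℂ} {d : A →ₗ[ℂ] ℂ} (hd : d ∈ pointDer φ) :
    ∃ L : Ω[A⁄ℂ] →+ ℂ, (∀ a ω, L (a • ω) = φ a * L ω) ∧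
      ∀ a, L (KaehlerDifferential.D ℂ A a) = d a := by
  let : Module A ℂ := Module.compHom ℂ φ.toRingHom
  have : IsScalarTower ℂ A ℂ := ⟨fun c a z => by
    change φ (c • a) * z = c * (φ a * z)
    rw [map_smul, smul_eq_mul, mul_assoc]⟩
  let D : Derivation ℂ A ℂ := Derivation.mk' d fun a b => hd a b
  exact ⟨D.liftKaehlerDifferential.toAddMonoidHom, fun a ω => D.liftKaehlerDifferential.map_smul a ω,
    fun a => D.liftKaehlerDifferential_comp_D a⟩

theorem mem_pointDer_of_kaehler {φ : A →ₐ[ℂ] ℂ} {d : A →ₗ[ℂ] ℂ} {L : Ω[A⁄ℂ] →+ ℂ}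
    (hL : ∀ a ω, L (a • ω) = φ a * L ω) (h : ∀ a, L (KaehlerDifferential.D ℂ A a) = d a) :
    d ∈ pointDer φ := fun a b => by
  rw [← h, Derivation.leibniz, map_add, hL, hL, h, h]

/-- If the differentials of the `f j` span the cotangent space at `φ₀`, then they span the
Kähler differentials up to multiplication by a function not vanishing at `φ₀`. -/
theorem exists_smul_kaehler_mem_span [Algebra.FiniteType ℂ A] (φ₀ : A →ₐ[ℂ] ℂ) {κ : Type*}
    (f : κ → A) (hf : ∀ d ∈ pointDer φ₀, (∀ j, d (f j) = 0) → d = 0) :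
    ∃ g : A, φ₀ g ≠ 0 ∧ ∀ ω : Ω[A⁄ℂ],
      g • ω ∈ Submodule.span A (Set.range fun j => KaehlerDifferential.D ℂ A (f j)) := by
  set N := Submodule.span A (Set.range fun j => KaehlerDifferential.D ℂ A (f j))
  set I := RingHom.ker φ₀
  -- Otherwise a nonzero ℂ-linear functional kills this sum. Killing I • Ω makes it φ₀-linear, hence
  -- a derivation at φ₀, and killing N makes that derivation vanish on every `f j`.
  have key : N ⊔ I • (⊤ : Submodule A Ω[A⁄ℂ]) = ⊤ := by
    by_contra hne
    set P := N ⊔ I • (⊤ : Submodule A Ω[A⁄ℂ]) with hP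
    obtain ⟨ω, hω⟩ : ∃ ω, ω ∉ P := by
      by_contra! h
      exact hne (eq_top_iff.2 fun x _ => h x)
    obtain ⟨L, hL, hLP⟩ := Submodule.exists_le_ker_of_notMem (p := P.restrictScalars ℂ) (v := ω) hω
    have hLs : ∀ a ω, L (a • ω) = φ₀ a * L ω := fun a ω => by
      have h1 : (a - algebraMap ℂ A (φ₀ a)) • ω ∈ P :=
        Submodule.mem_sup_right (Submodule.smul_mem_smul (by simp [I, RingHom.mem_ker]) trivial)
      have h2 : L ((a - algebraMap ℂ A (φ₀ a)) • ω) = 0 := hLP h1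
      rw [sub_smul, map_sub, algebraMap_smul A (φ₀ a) ω, L.map_smul (φ₀ a), sub_eq_zero] at h2
      exact h2
    have hd : L ∘ₗ (KaehlerDifferential.D ℂ A).toLinearMap = 0 := by
      refine hf _ (mem_pointDer_of_kaehler (L := L.toAddMonoidHom) hLs fun a => rfl) fun j => ?_
      exact hLP (Submodule.mem_sup_left (Submodule.subset_span ⟨j, rfl⟩))
    have hLz : ∀ ω, L ω = 0 := fun ω => by
      have : ω ∈ Submodule.span A (Set.range (KaehlerDifferential.D ℂ A)) := by
        rw [KaehlerDifferential.span_range_derivation]; trivial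
      induction this using Submodule.span_induction with
      | mem x hx => obtain ⟨a, rfl⟩ := hx; exact LinearMap.congr_fun hd a
      | zero => exact map_zero L
      | add x y _ _ hx hy => rw [map_add, hx, hy, add_zero]
      | smul a x _ hx => rw [hLs, hx, mul_zero]
    exact hL (hLz ω)
  -- Nakayama: some g ≡ 1 modulo I multiplies all of Ω into N.
  obtain ⟨g, hg, hgN⟩ := Submodule.exists_sub_one_mem_and_smul_le_of_fg_of_le_sup (I := I) (N := N)
    (N' := ⊤) (P := ⊤) Module.Finite.fg_top le_rfl key.ge
  refine ⟨g, ?_, fun ω => hgN (Submodule.smul_mem_pointwise_smul ω g _ trivial)⟩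
  rw [RingHom.mem_ker, map_sub, map_one, sub_eq_zero] at hg
  rw [hg]; exact one_ne_zero

/-- If the joint evaluation V → ℂ^κ were not onto, a nonzero functional on ℂ^κ vanishing on its
image would be a linear relation among the `v i`. -/
theorem exists_dual_family {V κ : Type*} [AddCommGroup V] [Module ℂ V] [Finite κ] [DecidableEq κ]
    {v : κ → V →ₗ[ℂ] ℂ} (hv : LinearIndependent ℂ v) :
    ∃ f : κ → V, ∀ i j, v i (f j) = if i = j then 1 else 0 := by
  have := Fintype.ofFinite κ
  have hs : LinearMap.range (LinearMap.pi v) = ⊤ := by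
    by_contra hne
    obtain ⟨c, hc, hcr⟩ := Submodule.exists_le_ker_of_lt_top _ (lt_top_iff_ne_top.2 hne)
    have h0 : ∑ i, c (Pi.single i 1) • v i = 0 := by
      ext a
      have : c (LinearMap.pi v a) = 0 := hcr ⟨a, rfl⟩
      rw [LinearMap.pi_apply_eq_sum_univ] at this
      have e (i : κ) : (fun j => if i = j then (1 : ℂ) else 0) = Pi.single i 1 := by
        ext j; simp [Pi.single_apply, eq_comm]
      simpa [mul_comm, e] using this
    have h1 := Fintype.linearIndependent_iff.1 hv _ h0
    refine hc (LinearMap.pi_ext' fun i => LinearMap.ext_ring ?_)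
    simpa using h1 i
  choose f hf using fun j => (LinearMap.range_eq_top.1 hs (Pi.single j (1 : ℂ)))
  exact ⟨f, fun i j => by simpa [Pi.single_apply] using congrFun (hf j) i⟩

/-- The locus where finitely many algebraic vector fields span the tangent space is open. -/
theorem exists_finset_pointDer_le_span [Algebra.FiniteType ℂ A] (φ₀ : A →ₐ[ℂ] ℂ) {ι : Type*}
    (D : ι → A → A) (v : ι → A →ₗ[ℂ] ℂ) (hv : ∀ i, v i ∈ pointDer φ₀)
    (hD : ∀ i a, v i a = φ₀ (D i a)) (hspan : pointDer φ₀ ≤ Submodule.span ℂ (Set.range v)) :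
    ∃ (s : Finset ι) (g : A), φ₀ g ≠ 0 ∧ ∀ φ : A →ₐ[ℂ] ℂ, φ g ≠ 0 → ∀ w : ι → A →ₗ[ℂ] ℂ,
      (∀ i ∈ s, w i ∈ pointDer φ) → (∀ i ∈ s, ∀ a, w i a = φ (D i a)) →
      pointDer φ ≤ Submodule.span ℂ (w '' s) := by
  classical
  have := finiteDimensional_pointDer φ₀
  obtain ⟨κ, e, he, hspan', hli⟩ :=
    exists_linearIndependent' ℂ (fun i => (⟨v i, hv i⟩ : pointDer φ₀))
  have : Finite κ := hli.finite
  have := Fintype.ofFinite κ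
  have hli' : LinearIndependent ℂ (v ∘ e) :=
    hli.map' (pointDer φ₀).subtype (Submodule.ker_subtype _)
  have hspan₂ : pointDer φ₀ ≤ Submodule.span ℂ (Set.range (v ∘ e)) := by
    refine hspan.trans ?_
    have := congrArg (Submodule.map (pointDer φ₀).subtype) hspan'
    rw [Submodule.map_span, Submodule.map_span, ← Set.range_comp, ← Set.range_comp] at this
    exact this.ge
  -- Functions dual to the chosen basis of tangent vectors act as local coordinates at φ₀: a
  -- derivation there that kills all of them is zero.
  obtain ⟨f, hf⟩ := exists_dual_family hli'
  obtain ⟨g, hg, hgs⟩ := exists_smul_kaehler_mem_span φ₀ f fun d hd h0 => by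
    obtain ⟨c, rfl⟩ := (Submodule.mem_span_range_iff_exists_fun ℂ).1 (hspan₂ hd)
    refine Finset.sum_eq_zero fun j _ => ?_
    have := h0 j
    simp only [LinearMap.sum_apply, LinearMap.smul_apply, hf, smul_eq_mul, mul_ite, mul_one,
      mul_zero, Finset.sum_ite_eq', Finset.mem_univ, if_true] at this
    rw [this, zero_smul]
  let M : Matrix κ κ A := Matrix.of fun j i => D (e i) (f j)
  have hM : M.map φ₀ = 1 := by
    ext j i
    simp only [M, Matrix.map_apply, Matrix.of_apply, ← hD]
    rw [show v (e i) (f j) = _ from hf i j, Matrix.one_apply]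
    simp [eq_comm]
  -- At φ₀ the matrix is the identity, so g * det M does not vanish there. Where it does not vanish,
  -- invertibility of M yields coefficients c for which Σ c_i w_i agrees with d on every `f j`.
  refine ⟨Finset.univ.image e, g * M.det, ?_, fun φ hφ w hw hwD d hd => ?_⟩
  · rw [map_mul, AlgHom.map_det, AlgHom.mapMatrix_apply, hM]
    simpa using hg
  rw [map_mul, AlgHom.map_det, AlgHom.mapMatrix_apply] at hφ
  have hu : IsUnit (M.map φ) := (Matrix.isUnit_iff_isUnit_det _).2 (right_ne_zero_of_mul hφ).isUnit
  obtain ⟨c, hc⟩ := (Matrix.mulVec_surjective_iff_isUnit.2 hu) fun j => d (f j)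
  have hmem : ∀ i, e i ∈ Finset.univ.image e := fun i =>
    Finset.mem_image_of_mem _ (Finset.mem_univ i)
  -- The difference kills the span of the differentials of the `f j`, which contains g • Ω. Since φ
  -- g ≠ 0, it kills Ω.
  have hsub : d - ∑ i, c i • w (e i) = 0 := by
    have hd' : d - ∑ i, c i • w (e i) ∈ pointDer φ :=
      sub_mem hd (sum_mem fun i _ => Submodule.smul_mem _ _ (hw _ (hmem i)))
    obtain ⟨L, hL, hLd⟩ := exists_kaehler_of_mem_pointDer hd'
    have hLN : ∀ ω ∈ Submodule.span A (Set.range fun j => KaehlerDifferential.D ℂ A (f j)),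
        L ω = 0 := fun ω hω => by
      induction hω using Submodule.span_induction with
      | mem x hx =>
        obtain ⟨j, rfl⟩ := hx
        have := congrFun hc j
        simp only [Matrix.mulVec, dotProduct, Matrix.map_apply, M, Matrix.of_apply] at this
        simp only [hLd, LinearMap.sub_apply, LinearMap.sum_apply, LinearMap.smul_apply, smul_eq_mul,
          hwD _ (hmem _), ← this, mul_comm, sub_self]
      | zero => exact map_zero L
      | add x y _ _ hx hy => rw [map_add, hx, hy, add_zero]
      | smul a x _ hx => rw [hL, hx, mul_zero]
    ext a
    have := hLN _ (hgs (KaehlerDifferential.D ℂ A a))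
    rw [hL, hLd] at this
    exact (mul_eq_zero.1 this).resolve_left (left_ne_zero_of_mul hφ)
  rw [sub_eq_zero.1 hsub]
  exact sum_mem fun i _ => Submodule.smul_mem _ _
    (Submodule.subset_span ⟨e i, by exact_mod_cast hmem i, rfl⟩)

end pointDer

end CAlg

/-! ### Flows on T-valued points, the composed spray and its submersivity. -/

namespace CAlg

noncomputable section

theorem appTop_const {X Y : CSch} (f : X ⟶ Y) (c : ℂ) : f.left.appTop (const Y c) = const X c := by
  have h : Y.hom.appTop ≫ f.left.appTop = X.hom.appTop := by
    rw [← Scheme.Hom.comp_appTop, Over.w f]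
  exact congr($h ((Scheme.ΓSpecIso (CommRingCat.of ℂ)).inv c))

theorem comp_pairing {n : Type} {S T X : CSch} (h : S ⟶ T) (u : T ⟶ X) (t : n → Γ(T.left, ⊤)) :
    h ≫ pairing u t = pairing (h ≫ u) (fun i => h.left.appTop (t i)) := by
  ext : 1
  exact AffineSpace.comp_homOfVector _ _ _

theorem pairing_proj {n : Type} {T X : CSch} (u : T ⟶ X) (t : n → Γ(T.left, ⊤)) :
    pairing u t ≫ proj n X = u := by
  ext : 1
  exact AffineSpace.homOfVector_over _ _

theorem appTop_pairing_coord {n : Type} {T X : CSch} (u : T ⟶ X) (t : n → Γ(T.left, ⊤)) (i : n) :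
    (pairing u t).left.appTop (AffineSpace.coord X.left i) = t i :=
  AffineSpace.homOfVector_appTop_coord _ _ _

theorem eq_pairing {n : Type} {T X : CSch} (h : T ⟶ affProd n X) :
    h = pairing (h ≫ proj n X) (fun i => h.left.appTop (AffineSpace.coord X.left i)) := by
  ext : 1
  apply AffineSpace.hom_ext
  · exact (AffineSpace.homOfVector_over _ _).symm
  · exact fun i => (appTop_pairing_coord (h ≫ proj n X)
      (fun i => h.left.appTop (AffineSpace.coord X.left i)) i).symm

theorem affMap_eq_pairing (n : Type) {X Y : CSch} (f : X ⟶ Y) :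
    affMap n f = pairing (proj n X ≫ f) (fun i => AffineSpace.coord X.left i) := by
  rw [eq_pairing (affMap n f)]
  congr 1
  · ext : 1
    exact AffineSpace.map_over f.left
  · ext i
    exact AffineSpace.map_appTop_coord f.left i

theorem comp_act {S T X : CSch} (σ : affProd Unit X ⟶ X) (h : S ⟶ T) (u : T ⟶ X)
    (t : Γ(T.left, ⊤)) : h ≫ act σ u t = act σ (h ≫ u) (h.left.appTop t) := by
  rw [act, ← Category.assoc, comp_pairing, act]

/-- The flow for time -c inverts the flow for time c. -/
theorem OneParamUnipotent.isIso_act_const {T X : CSch} (σ : OneParamUnipotent X) (u : T ⟶ X)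
    [IsIso u] (c : ℂ) : IsIso (act σ.map u (const T c)) := by
  have h (a b : ℂ) (hab : a + b = 0) :
      act σ.map (𝟙 X) (const X a) ≫ act σ.map (𝟙 X) (const X b) = 𝟙 X := by
    rw [comp_act, appTop_const, Category.comp_id, ← σ.act_add, ← map_add, hab, map_zero, σ.act_zero]
  have : IsIso (act σ.map (𝟙 X) (const X c)) :=
    ⟨_, h c (-c) (add_neg_cancel c), h (-c) c (neg_add_cancel c)⟩
  have e : act σ.map u (const T c) = u ≫ act σ.map (𝟙 X) (const X c) := by
    rw [comp_act, appTop_const, Category.comp_id]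
  rw [e]
  infer_instance

/-- The successive flow `p ↦ σ_N(… σ₁(u(p), t₁(p)) …, t_N(p))` along a morphism `u`. -/
def flow {T X : CSch} {N : ℕ} (σ : Fin N → OneParamUnipotent X) (u : T ⟶ X)
    (t : Fin N → Γ(T.left, ⊤)) : T ⟶ X :=
  Fin.foldl N (fun u i => act (σ i).map u (t i)) u

theorem flow_succ {T X : CSch} {N : ℕ} (σ : Fin (N + 1) → OneParamUnipotent X) (u : T ⟶ X)
    (t : Fin (N + 1) → Γ(T.left, ⊤)) :
    flow σ u t = flow (fun i => σ i.succ) (act (σ 0).map u (t 0)) (fun i => t i.succ) :=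
  Fin.foldl_succ _ _

theorem flow_nil {T X : CSch} (σ : Fin 0 → OneParamUnipotent X) (u : T ⟶ X)
    (t : Fin 0 → Γ(T.left, ⊤)) : flow σ u t = u :=
  Fin.foldl_zero _ _

theorem comp_flow {S T X : CSch} {N : ℕ} (σ : Fin N → OneParamUnipotent X) (h : S ⟶ T) (u : T ⟶ X)
    (t : Fin N → Γ(T.left, ⊤)) :
    h ≫ flow σ u t = flow σ (h ≫ u) (fun i => h.left.appTop (t i)) := by
  induction N generalizing u with
  | zero => rw [flow_nil, flow_nil]
  | succ N ih => rw [flow_succ, flow_succ, ih, comp_act]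

theorem flow_zero {T X : CSch} {N : ℕ} (σ : Fin N → OneParamUnipotent X) (u : T ⟶ X) :
    flow σ u 0 = u := by
  induction N generalizing u with
  | zero => rw [flow_nil]
  | succ N ih => rw [flow_succ, Pi.zero_apply, (σ 0).act_zero]; exact ih _ _

/-- Flows for time zero are trivial, so only the i-th factor remains. This identifies the composed
spray on a coordinate axis. -/
theorem flow_single {T X : CSch} {N : ℕ} (σ : Fin N → OneParamUnipotent X) (u : T ⟶ X)
    (i : Fin N) (a : Γ(T.left, ⊤)) :
    flow σ u (Pi.single i a) = act (σ i).map u a := by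
  induction N generalizing u with
  | zero => exact i.elim0
  | succ N ih =>
    rw [flow_succ]
    refine Fin.cases ?_ (fun j => ?_) i
    · have e : (fun i : Fin N => (Pi.single 0 a : Fin (N + 1) → Γ(T.left, ⊤)) i.succ) = 0 := by
        ext i; simp
      rw [e, flow_zero, Pi.single_eq_same]
    · have e : (fun i : Fin N => (Pi.single j.succ a : Fin (N + 1) → Γ(T.left, ⊤)) i.succ) =
          Pi.single j a := by
        ext i; simp [Pi.single_apply]
      rw [e, ih, Pi.single_eq_of_ne (Fin.succ_ne_zero j).symm, (σ 0).act_zero]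

theorem isIso_flow_const {T X : CSch} {N : ℕ} (σ : Fin N → OneParamUnipotent X) (u : T ⟶ X)
    [IsIso u] (w : Fin N → ℂ) : IsIso (flow σ u (fun i => const T (w i))) := by
  induction N generalizing u with
  | zero => rwa [flow_nil]
  | succ N ih =>
    rw [flow_succ]
    have := (σ 0).isIso_act_const u (w 0)
    exact ih (fun i => σ i.succ) _ (fun i => w i.succ)

theorem composedSpray_eq_flow {X : CSch} {N : ℕ} (σ : Fin N → OneParamUnipotent X) :
    composedSpray σ = flow σ (proj (Fin N) X) (AffineSpace.coord X.left) := rfl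

theorem pairing_composedSpray {T X : CSch} {N : ℕ} (σ : Fin N → OneParamUnipotent X) (u : T ⟶ X)
    (t : Fin N → Γ(T.left, ⊤)) : pairing u t ≫ composedSpray σ = flow σ u t := by
  rw [composedSpray_eq_flow, comp_flow, pairing_proj]
  congr 1
  ext i
  exact appTop_pairing_coord u t i

theorem isSpray_composedSpray {X : CSch} {N : ℕ} (σ : Fin N → OneParamUnipotent X) :
    IsSpray (𝟙 X) (composedSpray σ) := by
  rw [IsSpray, slice, pairing_composedSpray]
  simpa [Pi.zero_def] using flow_zero σ (𝟙 X)

theorem isIso_slice_composedSpray {X : CSch} {N : ℕ} (σ : Fin N → OneParamUnipotent X)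
    (w : Fin N → ℂ) : IsIso (slice X w ≫ composedSpray σ) := by
  rw [slice, pairing_composedSpray]
  exact isIso_flow_const σ (𝟙 X) w

theorem const_pointC_surjective : Function.Surjective (const pointC) := fun f =>
  ⟨(Scheme.ΓSpecIso (CommRingCat.of ℂ)).hom f, by simp [const]⟩

/-- The coordinates of a complex point are functions on Spec ℂ, hence constants; they form the
vector w. -/
theorem exists_eq_comp_slice {n : Type} {X : CSch} (z : CPoint (affProd n X)) :
    ∃ w : n → ℂ, z = (z ≫ proj n X) ≫ slice X w := by
  choose w hw using fun i => const_pointC_surjective (z.left.appTop (AffineSpace.coord X.left i))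
  refine ⟨w, ?_⟩
  rw [slice, comp_pairing, Category.comp_id]
  simp only [appTop_const, hw]
  exact eq_pairing z

/-! ### Functoriality of the differential -/

/-- The derivative of a section along a tangent vector. -/
def tanEval {X : CSch} {x : CPoint X} (v : TangentSp x) (V : X.left.Opens) (hV : x.pt ∈ V)
    (f : Γ(X.left, V)) : ℂ := v (X.left.presheaf.germ V x.pt hV f)

theorem tangent_ext {X : CSch} {x : CPoint X} {v w : TangentSp x}
    (h : ∀ V hV f, tanEval v V hV f = tanEval w V hV f) : v = w := by
  ext g
  obtain ⟨V, hV, f, rfl⟩ := TopCat.Presheaf.exists_germ_eq X.left.presheaf g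
  exact h V hV f

theorem tanEval_differential {X Y : CSch} (f : X ⟶ Y) (x : CPoint X) (v : TangentSp x)
    (V : Y.left.Opens) (hV : CPoint.pt (x ≫ f) ∈ V) (s : Γ(Y.left, V)) :
    tanEval (differential f x v) V hV s = tanEval v (f.left ⁻¹ᵁ V) hV (f.left.app V s) := by
  change (v (pullGerm f x _) : ℂ) = v _
  congr 1
  exact Scheme.Hom.germ_stalkMap_apply f.left V x.pt hV s

theorem tanEval_tangentCongr {X : CSch} {x y : CPoint X} (h : x = y) (v : TangentSp x)
    (V : X.left.Opens) (hV : y.pt ∈ V) (s : Γ(X.left, V)) :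
    tanEval (tangentCongr h v) V hV s = tanEval v V (h ▸ hV) s := by
  subst h; rfl

theorem differential_comp {X Y Z : CSch} (f : X ⟶ Y) (g : Y ⟶ Z) (x : CPoint X) (v : TangentSp x) :
    tangentCongr (Category.assoc x f g) (differential g (x ≫ f) (differential f x v)) =
      differential (f ≫ g) x v := by
  refine tangent_ext fun V hV s => ?_
  rw [tanEval_tangentCongr, tanEval_differential, tanEval_differential]
  exact tanEval_differential f x v _ _ _

theorem differential_id {X : CSch} (x : CPoint X) (v : TangentSp x) :
    differential (𝟙 X) x v = tangentCongr (Category.comp_id x).symm v := by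
  refine tangent_ext fun V hV s => ?_
  rw [tanEval_tangentCongr, tanEval_differential]
  rfl

/-- The chain rule with all base points free up to equality, so that it applies where points agree
only propositionally. -/
theorem differential_differential {X Y Z : CSch} {f : X ⟶ Y} {g : Y ⟶ Z} {k : X ⟶ Z}
    (hk : f ≫ g = k) {x : CPoint X} {y : CPoint Y} {z : CPoint Z} (hy : x ≫ f = y) (hz : y ≫ g = z)
    (hz' : x ≫ k = z) (v : TangentSp x) :
    tangentCongr hz (differential g y (tangentCongr hy (differential f x v))) =
      tangentCongr hz' (differential k x v) := by
  subst hy hz hk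
  rw [← differential_comp]
  refine tangent_ext fun V hV s => ?_
  rw [tanEval_tangentCongr, tanEval_tangentCongr, tanEval_tangentCongr]
  rfl

theorem IsSubmersionAt.congr_point {X Y : CSch} {f : X ⟶ Y} {x y : CPoint X} (h : x = y)
    (hf : IsSubmersionAt f x) : IsSubmersionAt f y := h ▸ hf

theorem IsSubmersionAt.of_comp {X Y Z : CSch} {f : X ⟶ Y} {g : Y ⟶ Z} {x : CPoint X}
    (h : IsSubmersionAt (f ≫ g) x) : IsSubmersionAt g (x ≫ f) := fun v => by
  obtain ⟨ξ, hξ⟩ := h (tangentCongr (Category.assoc x f g) v)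
  exact ⟨differential f x ξ, (tangentCongr (Category.assoc x f g)).injective
    ((differential_comp f g x ξ).trans hξ)⟩

theorem IsSubmersionAt.comp {X Y Z : CSch} {f : X ⟶ Y} {g : Y ⟶ Z} {x : CPoint X}
    (hf : IsSubmersionAt f x) (hg : IsSubmersionAt g (x ≫ f)) : IsSubmersionAt (f ≫ g) x :=
  fun v => by
  obtain ⟨η, hη⟩ := hg ((tangentCongr (Category.assoc x f g)).symm v)
  obtain ⟨ξ, rfl⟩ := hf η
  exact ⟨ξ, by rw [← differential_comp, hη, LinearEquiv.apply_symm_apply]⟩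

theorem isSubmersionAt_id {X : CSch} (x : CPoint X) : IsSubmersionAt (𝟙 X) x := fun v =>
  ⟨(tangentCongr (Category.comp_id x).symm).symm v, by
    rw [differential_id, LinearEquiv.apply_symm_apply]⟩

theorem isSubmersionAt_of_isIso {X Y : CSch} (f : X ⟶ Y) [IsIso f] (x : CPoint X) :
    IsSubmersionAt f x := by
  have h : IsSubmersionAt (inv f ≫ f) (x ≫ f) := by
    rw [IsIso.inv_hom_id]; exact isSubmersionAt_id _
  exact h.of_comp.congr_point (by simp)

/-- Composition with the inverse of the stalk isomorphism, which respects constants and evaluation,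
lifts every derivation. -/
theorem isSubmersionAt_of_isIso_stalkMap {X Y : CSch} (f : X ⟶ Y) (x : CPoint X)
    [IsIso (f.left.stalkMap x.pt)] : IsSubmersionAt f x := fun v => by
  let e : CPoint.localRing (x ≫ f) ≃+* x.localRing :=
    (asIso (f.left.stalkMap x.pt)).commRingCatIsoToRingEquiv
  have he (g) : e g = pullGerm f x g := rfl
  have hev (g : x.localRing) : CPoint.eval (x ≫ f) (e.symm g) = x.eval g := by
    rw [← eval_pullGerm, ← he, e.apply_symm_apply]
  have hc (c : ℂ) : e.symm (algebraMap ℂ x.localRing c) =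
      algebraMap ℂ (CPoint.localRing (x ≫ f)) c := by
    rw [e.symm_apply_eq, he, pullGerm_algebraMap]
  let D : TangentSp x := Derivation.mk'
    { toFun := fun g => (v (e.symm g) : ℂ)
      map_add' := fun g h => by rw [map_add, map_add]; rfl
      map_smul' := fun c g => by
        rw [Algebra.smul_def, map_mul, hc, ← Algebra.smul_def, v.map_smul]; rfl }
    (fun g h => by
      refine ((congrArg v (map_mul e.symm g h)).trans (v.leibniz _ _)).trans ?_
      have e' (g : x.localRing) (z : ℂ) :
          CPoint.eval (x ≫ f) (e.symm g) * z = x.eval g * z := by rw [hev]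
      exact congrArg₂ (fun a b : ℂ => a + b) (e' g (v (e.symm h))) (e' h (v (e.symm g))))
  refine ⟨D, ?_⟩
  ext g
  change (v (e.symm (e g)) : ℂ) = v g
  rw [e.symm_apply_apply]

theorem isSubmersionAt_incl (Y : CSch) (U : Y.left.Opens) (x : CPoint (opn Y U)) :
    IsSubmersionAt (incl Y U) x := by
  have : IsOpenImmersion (incl Y U).left := inferInstanceAs (IsOpenImmersion U.ι)
  exact isSubmersionAt_of_isIso_stalkMap _ _

/-- The slice through z is mapped isomorphically, so the differential is onto already on vectors
tangent to that slice. -/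
theorem isSubmersionAt_composedSpray {X : CSch} {N : ℕ} (σ : Fin N → OneParamUnipotent X)
    (z : CPoint (affProd (Fin N) X)) : IsSubmersionAt (composedSpray σ) z := by
  obtain ⟨w, hw⟩ := exists_eq_comp_slice z
  have := isIso_slice_composedSpray σ w
  exact (isSubmersionAt_of_isIso (slice X w ≫ composedSpray σ) (z ≫ proj _ X)).of_comp.congr_point
    hw.symm

theorem sing_eq_empty {X Y : CSch} {f : X ⟶ Y} (h : ∀ x, IsSubmersionAt f x) : Sing f = ∅ :=
  Set.eq_empty_of_forall_notMem fun _ ⟨x, _, hx⟩ => hx (h x)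

/-! ### Domination -/

/-- The `i`-th coordinate axis `ℂ ⟶ ℂᴺ`. -/
def axis {N : ℕ} (i : Fin N) : affProd Unit pointC ⟶ affProd (Fin N) pointC :=
  pairing (proj Unit pointC) (Pi.single i (AffineSpace.coord pointC.left ()))

theorem axis_composedSpray {X : CSch} {N : ℕ} (σ : Fin N → OneParamUnipotent X) (x : CPoint X)
    (i : Fin N) : axis i ≫ affMap (Fin N) x ≫ composedSpray σ = (σ i).orbit x := by
  rw [affMap_eq_pairing, pairing_composedSpray, comp_flow, ← Category.assoc, axis, pairing_proj]
  simp only [appTop_pairing_coord]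
  rw [flow_single, OneParamUnipotent.orbit, affMap_eq_pairing]
  rfl

theorem origin_axis {N : ℕ} (i : Fin N) : origin Unit ≫ axis i = origin (Fin N) := by
  rw [axis, comp_pairing, origin, slice, pairing_proj, origin, slice]
  congr 1
  ext j
  rcases eq_or_ne j i with rfl | h
  · rw [Pi.single_eq_same, appTop_pairing_coord]; simp
  · rw [Pi.single_eq_of_ne h]; simp

/-- The tangent vector at `x` to the orbit of `σ`, with parameter velocity `ξ`. -/
def velocity {X : CSch} (σ : OneParamUnipotent X) (ξ : TangentSp (origin Unit)) (x : CPoint X) :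
    TangentSp x :=
  tangentCongr (σ.origin_orbit x) (differential (σ.orbit x) (origin Unit) ξ)

theorem isSubmersionAt_of_velocity {X : CSch} {N : ℕ} {σ : Fin N → OneParamUnipotent X}
    {x : CPoint X} {s : affProd (Fin N) pointC ⟶ X} (hs : ∀ i, axis i ≫ s = (σ i).orbit x)
    (hx : origin (Fin N) ≫ s = x)
    (h : Submodule.span ℂ {v | ∃ i ξ, v = velocity (σ i) ξ x} = ⊤) :
    IsSubmersionAt s (origin (Fin N)) := by
  suffices hr : LinearMap.range ((tangentCongr hx).toLinearMap ∘ₗ differential s (origin _)) = ⊤ by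
    intro v
    obtain ⟨ξ, hξ⟩ := LinearMap.range_eq_top.1 hr (tangentCongr hx v)
    exact ⟨ξ, (tangentCongr hx).injective hξ⟩
  rw [eq_top_iff, ← h, Submodule.span_le]
  rintro _ ⟨i, ξ, rfl⟩
  exact ⟨tangentCongr (origin_axis i) (differential (axis i) _ ξ),
    differential_differential (hs i) (origin_axis i) hx ((σ i).origin_orbit x) ξ⟩

theorem isDominating_composedSpray {X : CSch} {N : ℕ} (σ : Fin N → OneParamUnipotent X)
    (h : ∀ x : CPoint X, Submodule.span ℂ {v | ∃ i ξ, v = velocity (σ i) ξ x} = ⊤) :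
    IsDominating (composedSpray σ) := fun x => by
  refine isSubmersionAt_of_velocity (fun i => axis_composedSpray σ x i) ?_ (h x)
  rw [← Category.assoc, origin_affMap, Category.assoc, isSpray_composedSpray σ, Category.comp_id]

end

end CAlg

namespace CAlg

noncomputable section

/-! ### Pullback of sections to spectra -/

/-- The pullback of sections over `V` along a morphism `Spec R ⟶ X` with image in `V`. -/
def pullSec {X : Scheme.{0}} {R : CommRingCat.{0}} (g : Spec R ⟶ X) (V : X.Opens)
    (hV : ⊤ ≤ g ⁻¹ᵁ V) : Γ(X, V) ⟶ R :=
  g.appLE V ⊤ hV ≫ (Scheme.ΓSpecIso R).hom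

theorem pullSec_specMap_comp {X : Scheme.{0}} {R S : CommRingCat.{0}} (g : Spec R ⟶ X) (ψ : R ⟶ S)
    (V : X.Opens) (hV : ⊤ ≤ g ⁻¹ᵁ V) (hV' : ⊤ ≤ (Spec.map ψ ≫ g) ⁻¹ᵁ V) :
    pullSec (Spec.map ψ ≫ g) V hV' = pullSec g V hV ≫ ψ := by
  have h := Scheme.Hom.appLE_comp_appLE (Spec.map ψ) g V ⊤ ⊤ hV le_top
  rw [pullSec, ← h, pullSec, Category.assoc, Category.assoc, ← Scheme.ΓSpecIso_naturality]
  congr 2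

theorem pullSec_comp {X Y : Scheme.{0}} {R : CommRingCat.{0}} (g : Spec R ⟶ X) (f : X ⟶ Y)
    (V : Y.Opens) (hV : ⊤ ≤ (g ≫ f) ⁻¹ᵁ V) :
    pullSec (g ≫ f) V hV = f.app V ≫ pullSec g (f ⁻¹ᵁ V) hV := by
  rw [pullSec, Scheme.Hom.comp_appLE, Category.assoc]; rfl

theorem pullSec_top {X : Scheme.{0}} {R : CommRingCat.{0}} (g : Spec R ⟶ X) :
    pullSec g ⊤ le_rfl = g.appTop ≫ (Scheme.ΓSpecIso R).hom := by
  simp only [pullSec, Scheme.Hom.appLE]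
  exact congrArg (· ≫ _) (Category.comp_id _)

theorem map_pullSec {X : Scheme.{0}} {R : CommRingCat.{0}} (g : Spec R ⟶ X) {V W : X.Opens}
    (h : V ≤ W) (hV : ⊤ ≤ g ⁻¹ᵁ V) (hW : ⊤ ≤ g ⁻¹ᵁ W) :
    X.presheaf.map (homOfLE h).op ≫ pullSec g V hV = pullSec g W hW := by
  rw [pullSec, Scheme.Hom.map_appLE_assoc, pullSec]

theorem pullSec_fromSpecStalk {X : Scheme.{0}} (x : X) (V : X.Opens) (hx : x ∈ V)
    (hV : ⊤ ≤ X.fromSpecStalk x ⁻¹ᵁ V) :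
    pullSec (X.fromSpecStalk x) V hV = X.presheaf.germ V x hx := by
  rw [pullSec, Scheme.Hom.appLE, Scheme.fromSpecStalk_app hx]
  simp only [Category.assoc, ← Functor.map_comp_assoc]
  have : ((homOfLE le_top).op ≫ (homOfLE hV).op :
      Opposite.op (⊤ : (Spec (X.presheaf.stalk x)).Opens) ⟶ _) = 𝟙 _ := rfl
  rw [this]
  simp

theorem fromSpecStalk_preimage {X : Scheme.{0}} {R : CommRingCat.{0}} (x : X)
    (θ : X.presheaf.stalk x ⟶ R) (V : X.Opens) (hx : x ∈ V) :
    ⊤ ≤ (Spec.map θ ≫ X.fromSpecStalk x) ⁻¹ᵁ V := by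
  intro y _
  have h : (Spec.map θ ≫ X.fromSpecStalk x) y ∈ Set.range (X.fromSpecStalk x) :=
    ⟨Spec.map θ y, by simp⟩
  rw [Scheme.range_fromSpecStalk] at h
  exact h.mem_open V.2 hx

theorem CPoint.top_le_preimage {X : CSch} (x : CPoint X) (V : X.left.Opens) (hV : x.pt ∈ V) :
    ⊤ ≤ x.left ⁻¹ᵁ V :=
  (Scheme.preimage_eq_top_of_closedPoint_mem (R := CommRingCat.of ℂ) x.left hV).ge

theorem CPoint.eval_germ {X : CSch} (x : CPoint X) (V : X.left.Opens) (hV : x.pt ∈ V)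
    (f : Γ(X.left, V)) :
    x.eval (X.left.presheaf.germ V x.pt hV f) =
      pullSec (R := CommRingCat.of ℂ) x.left V (x.top_le_preimage V hV) f := by
  have h := Scheme.germ_stalkClosedPointTo (R := CommRingCat.of ℂ) x.left V hV
  rw [Iso.trans_hom, Functor.mapIso_hom, Subsingleton.elim (Iso.hom _)
    (homOfLE (x.top_le_preimage V hV)).op, ← Category.assoc] at h
  exact congr($h f)

theorem CPoint.eval_algebraMap {X : CSch} (x : CPoint X) (c : ℂ) :
    x.eval (algebraMap ℂ x.localRing c) = c := by
  change x.eval (X.left.presheaf.germ ⊤ x.pt trivial (const X c)) = c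
  rw [x.eval_germ ⊤ trivial]
  have h := pullSec_top (R := CommRingCat.of ℂ) x.left
  refine congr($h (const X c)).trans ?_
  rw [CommRingCat.comp_apply, appTop_const]
  simp [const]

/-- The value of a tangent vector on a germ, as a complex number. -/
def tangentApply {X : CSch} {x : CPoint X} (v : TangentSp x) (g : x.localRing) : ℂ := v g

/-! ### Tangent vectors as derivations of an affine coordinate ring -/

instance sectionsAlgebra (X : CSch) (V : X.left.Opens) : Algebra ℂ Γ(X.left, V) :=
  ((X.left.presheaf.map (homOfLE le_top).op).hom.comp (const X)).toAlgebra

theorem germ_algebraMap {X : CSch} (x : CPoint X) (V : X.left.Opens) (hV : x.pt ∈ V) (c : ℂ) :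
    X.left.presheaf.germ V x.pt hV (algebraMap ℂ Γ(X.left, V) c) = algebraMap ℂ x.localRing c :=
  TopCat.Presheaf.germ_res_apply X.left.presheaf (homOfLE le_top) x.pt hV (const X c)

/-- Evaluation of sections over `V` at a complex point of `V`. -/
def CPoint.evalSec {X : CSch} (x : CPoint X) (V : X.left.Opens) (hV : x.pt ∈ V) :
    Γ(X.left, V) →ₐ[ℂ] ℂ :=
  { x.eval.comp (X.left.presheaf.germ V x.pt hV).hom with
    commutes' := fun c => by
      change x.eval (X.left.presheaf.germ V x.pt hV _) = c
      rw [germ_algebraMap, x.eval_algebraMap] }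

/-- The restriction of a tangent vector to the sections over `V`. -/
def tanRes {X : CSch} (x : CPoint X) (V : X.left.Opens) (hV : x.pt ∈ V) :
    TangentSp x →ₗ[ℂ] (Γ(X.left, V) →ₗ[ℂ] ℂ) where
  toFun v :=
    { toFun := tanEval v V hV
      map_add' := fun f g => by
        change v _ = _
        rw [map_add, map_add]; rfl
      map_smul' := fun c f => by
        change v _ = _
        rw [Algebra.smul_def, map_mul, germ_algebraMap, ← Algebra.smul_def, v.map_smul]; rfl }
  map_add' _ _ := rfl
  map_smul' _ _ := rfl

theorem tangentApply_mul {X : CSch} {x : CPoint X} (v : TangentSp x) (f g : x.localRing) :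
    tangentApply v (f * g) = x.eval f * tangentApply v g + x.eval g * tangentApply v f :=
  v.leibniz f g

theorem tanRes_mem_pointDer {X : CSch} (x : CPoint X) (V : X.left.Opens) (hV : x.pt ∈ V)
    (v : TangentSp x) : tanRes x V hV v ∈ pointDer (x.evalSec V hV) := fun f g => by
  change tangentApply v _ = _
  rw [map_mul]
  exact tangentApply_mul v _ _

theorem exists_germ_mul_eq_germ {X : CSch} (x : CPoint X) {V : X.left.Opens}
    (hA : IsAffineOpen V) (hV : x.pt ∈ V) (g : x.localRing) :
    ∃ a b, x.evalSec V hV b ≠ 0 ∧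
      X.left.presheaf.germ V x.pt hV b * g = X.left.presheaf.germ V x.pt hV a := by
  let := X.left.presheaf.algebra_section_stalk ⟨x.pt, hV⟩
  have := hA.isLocalization_stalk ⟨x.pt, hV⟩
  obtain ⟨⟨a, b⟩, h⟩ := IsLocalization.surj (hA.primeIdealOf ⟨x.pt, hV⟩).asIdeal.primeCompl g
  refine ⟨a, b, ?_, (mul_comm _ _).trans h⟩
  have hu := IsLocalization.map_units (X.left.presheaf.stalk x.pt) b
  exact (hu.map x.eval).ne_zero

/-- A germ g satisfies b g = a with sections a, b and b(x) ≠ 0. If v kills sections, Leibniz gives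
b(x) v(g) = 0. -/
theorem tanRes_injective {X : CSch} (x : CPoint X) {V : X.left.Opens} (hA : IsAffineOpen V)
    (hV : x.pt ∈ V) : Function.Injective (tanRes x V hV) := by
  rw [← LinearMap.ker_eq_bot, LinearMap.ker_eq_bot']
  intro v hv
  ext g
  obtain ⟨a, b, hb, h⟩ := exists_germ_mul_eq_germ x hA hV g
  have h0 (f) : tangentApply v (X.left.presheaf.germ V x.pt hV f) = 0 := LinearMap.congr_fun hv f
  have h1 := tangentApply_mul v (X.left.presheaf.germ V x.pt hV b) g
  rw [h, h0, h0, mul_zero, add_zero] at h1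
  exact (mul_eq_zero.1 h1.symm).resolve_left hb

/-- The homomorphism `f ↦ f(x) + d(f) ε` to the dual numbers given by a derivation at a point. -/
def dualHom {R : Type*} [CommRing R] (φ : R →+* ℂ) (d : R →+ ℂ)
    (hd : ∀ a b, d (a * b) = φ a * d b + φ b * d a) : R →+* DualNumber ℂ where
  toFun a := (φ a, d a)
  map_one' := by
    have h := hd 1 1
    rw [map_one, mul_one, one_mul] at h
    refine TrivSqZeroExt.ext (map_one φ) ?_
    change d 1 = 0
    linear_combination -h
  map_mul' a b := by
    refine TrivSqZeroExt.ext (map_mul φ a b) ?_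
    change d (a * b) = φ a • d b + MulOpposite.op (φ b) • d a
    simp [hd, mul_comm]
  map_zero' := TrivSqZeroExt.ext (map_zero φ) (map_zero d)
  map_add' a b := TrivSqZeroExt.ext (map_add φ a b) (map_add d a b)

/-- The derivation is a homomorphism f ↦ f(x) + d(f) ε. A dual number with nonzero constant term is
a unit, so this homomorphism extends to the localization, which is the local ring; the ε-part is the
tangent vector. -/
theorem exists_tanRes_eq {X : CSch} (x : CPoint X) {V : X.left.Opens} (hA : IsAffineOpen V)
    (hV : x.pt ∈ V) {d : Γ(X.left, V) →ₗ[ℂ] ℂ} (hd : d ∈ pointDer (x.evalSec V hV)) :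
    ∃ v, tanRes x V hV v = d := by
  let := X.left.presheaf.algebra_section_stalk ⟨x.pt, hV⟩
  have := hA.isLocalization_stalk ⟨x.pt, hV⟩
  set M := (hA.primeIdealOf ⟨x.pt, hV⟩).asIdeal.primeCompl
  let θ := dualHom (x.evalSec V hV).toRingHom d.toAddMonoidHom hd
  have hθ (b : M) : IsUnit (θ b) := by
    rw [TrivSqZeroExt.isUnit_iff_isUnit_fst]
    exact (IsLocalization.map_units (X.left.presheaf.stalk x.pt) b).map x.eval
  let Θ : x.localRing →+* DualNumber ℂ := IsLocalization.lift (M := M) hθ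
  have hΘ (f) : Θ (X.left.presheaf.germ V x.pt hV f) = θ f := IsLocalization.lift_eq (M := M) hθ f
  have hfst (g) : (Θ g).fst = x.eval g := by
    have h : (TrivSqZeroExt.fstHom ℂ ℂ ℂ).toRingHom.comp Θ = x.eval := by
      refine IsLocalization.ringHom_ext M (RingHom.ext fun f => ?_)
      exact congrArg TrivSqZeroExt.fst (hΘ f)
    exact RingHom.congr_fun h g
  have hmul (f g) : (Θ (f * g)).snd = x.eval f * (Θ g).snd + x.eval g * (Θ f).snd := by
    rw [map_mul, TrivSqZeroExt.snd_mul, hfst, hfst]; simp [mul_comm]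
  have hconst (c : ℂ) : (Θ (algebraMap ℂ x.localRing c)).snd = 0 := by
    rw [← germ_algebraMap x V hV, hΘ]
    change d _ = 0
    have h1 := hd 1 1
    rw [map_one, mul_one, one_mul] at h1
    rw [Algebra.algebraMap_eq_smul_one, map_smul, show d 1 = 0 by linear_combination -h1, smul_zero]
  let D : TangentSp x := Derivation.mk'
    { toFun := fun g => ((Θ g).snd : ℂ)
      map_add' := fun g h => by rw [map_add]; rfl
      map_smul' := fun c g => by
        rw [Algebra.smul_def, hmul, hconst, mul_zero, add_zero, x.eval_algebraMap]; rfl }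
    hmul
  refine ⟨D, LinearMap.ext fun f => ?_⟩
  change (Θ (X.left.presheaf.germ V x.pt hV f)).snd = d f
  rw [hΘ]
  rfl

theorem finiteType_sections {X : CSch} [LocallyOfFiniteType X.hom] {V : X.left.Opens}
    (hA : IsAffineOpen V) : Algebra.FiniteType ℂ Γ(X.left, V) := by
  have h := LocallyOfFiniteType.finiteType_appLE X.hom (isAffineOpen_top SpecC) hA le_top
  have h2 := (RingHom.FiniteType.of_surjective (Scheme.ΓSpecIso (CommRingCat.of ℂ)).inv.hom
    (Scheme.ΓSpecIso (CommRingCat.of ℂ)).symm.commRingCatIsoToRingEquiv.surjective)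
  have h3 := h.comp h2
  have e : algebraMap ℂ Γ(X.left, V) = ((X.hom.appLE ⊤ V le_top).hom.comp
      (Scheme.ΓSpecIso (CommRingCat.of ℂ)).inv.hom) := by
    ext c
    rfl
  rwa [← e, RingHom.finiteType_algebraMap] at h3

end

end CAlg

namespace CAlg

noncomputable section

/-! ### Tangent vectors as points over the dual numbers -/

/-- The spectrum of a `ℂ`-algebra, as a scheme over `ℂ`. -/
abbrev specOver {B : Type} [CommRing B] (κ : ℂ →+* B) : CSch :=
  Over.mk (Spec.map (CommRingCat.ofHom κ))

/-- An element of a ring, as a function on its spectrum. -/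
def specFun {B : Type} [CommRing B] (b : B) : Γ(Spec (CommRingCat.of B), ⊤) :=
  (Scheme.ΓSpecIso (CommRingCat.of B)).inv b

/-- The morphism of spectra over `ℂ` given by a homomorphism. -/
def specHom {B C : Type} [CommRing B] [CommRing C] {κ : ℂ →+* B} {μ : ℂ →+* C} (ψ : B →+* C)
    (h : ψ.comp κ = μ) : specOver μ ⟶ specOver κ :=
  Over.homMk (Spec.map (CommRingCat.ofHom ψ)) (by
    subst h
    change Spec.map _ ≫ Spec.map _ = Spec.map _
    rw [← Spec.map_comp, ← CommRingCat.ofHom_comp])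

theorem appTop_specHom {B C : Type} [CommRing B] [CommRing C] {κ : ℂ →+* B} {μ : ℂ →+* C}
    (ψ : B →+* C) (h : ψ.comp κ = μ) (b : B) :
    (specHom ψ h).left.appTop (specFun b) = specFun (ψ b) :=
  congr($(Scheme.ΓSpecIso_inv_naturality (CommRingCat.ofHom ψ)) b).symm

theorem appTop_eq_specFun {X : Scheme.{0}} {B : Type} [CommRing B]
    (g : Spec (CommRingCat.of B) ⟶ X) (t : Γ(X, ⊤)) :
    g.appTop t = specFun (pullSec g ⊤ le_rfl t) := by
  rw [pullSec_top, specFun, CommRingCat.comp_apply]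
  simp

theorem comp_hom_eq_specMap {X : CSch} {B : Type} [CommRing B] {κ : ℂ →+* B}
    (g : Spec (CommRingCat.of B) ⟶ X.left)
    (h : ∀ c, pullSec g ⊤ le_rfl (const X c) = κ c) :
    g ≫ X.hom = Spec.map (CommRingCat.ofHom κ) := by
  refine ext_of_isAffine ?_
  rw [← cancel_epi (Scheme.ΓSpecIso (CommRingCat.of ℂ)).inv, ← Scheme.ΓSpecIso_inv_naturality]
  ext c
  have h1 := appTop_eq_specFun g (const X c)
  rw [h] at h1
  rw [Scheme.Hom.comp_appTop]
  exact h1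

theorem pullSec_congr {X : Scheme.{0}} {R : CommRingCat.{0}} {g g' : Spec R ⟶ X} (h : g = g')
    (V : X.Opens) (hV : ⊤ ≤ g ⁻¹ᵁ V) (hV' : ⊤ ≤ g' ⁻¹ᵁ V) : pullSec g V hV = pullSec g' V hV' := by
  subst h; rfl

theorem pullSec_fromSpec {X : Scheme.{0}} {V : X.Opens} (hA : IsAffineOpen V)
    (hV : ⊤ ≤ hA.fromSpec ⁻¹ᵁ V) : pullSec hA.fromSpec V hV = 𝟙 _ := by
  rw [pullSec, Scheme.Hom.appLE, hA.fromSpec_app_self]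
  simp only [Category.assoc, ← Functor.map_comp_assoc]
  rw [Subsingleton.elim (_ ≫ (homOfLE hV).op) (𝟙 _), CategoryTheory.Functor.map_id,
    Category.id_comp, Iso.inv_hom_id]

theorem top_le_fromSpec_preimage {X : Scheme.{0}} {V : X.Opens} (hA : IsAffineOpen V) :
    ⊤ ≤ hA.fromSpec ⁻¹ᵁ V := hA.fromSpec_preimage_self.ge

theorem specMap_pullSec_fromSpec {X : Scheme.{0}} {R : CommRingCat.{0}} {V : X.Opens}
    (hA : IsAffineOpen V) (g : Spec R ⟶ X) (hV : ⊤ ≤ g ⁻¹ᵁ V) :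
    Spec.map (pullSec g V hV) ≫ hA.fromSpec = g := by
  have hr : Set.range g ⊆ Set.range hA.fromSpec := by
    rw [hA.range_fromSpec]
    rintro _ ⟨y, rfl⟩
    exact hV (Set.mem_univ y)
  have hl := IsOpenImmersion.lift_fac hA.fromSpec g hr
  rw [← Spec.map_preimage (IsOpenImmersion.lift hA.fromSpec g hr)] at hl
  set ψ := Spec.preimage (IsOpenImmersion.lift hA.fromSpec g hr)
  have h1 : pullSec g V hV = ψ := by
    rw [pullSec_congr hl.symm V hV (hl ▸ hV),
      pullSec_specMap_comp _ _ _ (top_le_fromSpec_preimage hA), pullSec_fromSpec, Category.id_comp]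
  rw [h1, hl]

/-- The additive map underlying a tangent vector. -/
def tangentAddHom {X : CSch} {x : CPoint X} (v : TangentSp x) : x.localRing →+ ℂ where
  toFun := tangentApply v
  map_zero' := map_zero v
  map_add' := map_add v

/-- The homomorphism from the local ring to the dual numbers given by a tangent vector. -/
def tangentDual {X : CSch} {x : CPoint X} (v : TangentSp x) : x.localRing →+* DualNumber ℂ :=
  dualHom x.eval (tangentAddHom v) (tangentApply_mul v)

/-- The point over the dual numbers given by a tangent vector. -/
def tangentHom {X : CSch} {x : CPoint X} (v : TangentSp x) :
    specOver (algebraMap ℂ (DualNumber ℂ)) ⟶ X :=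
  Over.homMk (Spec.map (CommRingCat.ofHom (tangentDual v)) ≫ X.left.fromSpecStalk x.pt) (by
    refine comp_hom_eq_specMap _ fun c => ?_
    have h1 := pullSec_specMap_comp (X.left.fromSpecStalk x.pt)
      (CommRingCat.ofHom (tangentDual v)) ⊤ le_rfl le_rfl
    refine (congr($h1 (const X c)).trans (congrArg (tangentDual v)
      congr($(pullSec_fromSpecStalk x.pt ⊤ trivial le_rfl) (const X c)))).trans ?_
    exact TrivSqZeroExt.ext (x.eval_algebraMap c) (v.map_algebraMap c))

theorem pullSec_tangentHom {X : CSch} {x : CPoint X} (v : TangentSp x) (V : X.left.Opens)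
    (hV : x.pt ∈ V) (h : ⊤ ≤ (tangentHom v).left ⁻¹ᵁ V) (f : Γ(X.left, V)) :
    pullSec (tangentHom v).left V h f = tangentDual v (X.left.presheaf.germ V x.pt hV f) := by
  have hV' : ⊤ ≤ X.left.fromSpecStalk x.pt ⁻¹ᵁ V := by
    simpa using fromSpecStalk_preimage x.pt (𝟙 _) V hV
  have h1 := pullSec_specMap_comp (X.left.fromSpecStalk x.pt)
    (CommRingCat.ofHom (tangentDual v)) V hV' h
  rw [pullSec_fromSpecStalk _ _ hV] at h1
  exact congr($h1 f)

theorem top_le_tangentHom_preimage {X : CSch} {x : CPoint X} (v : TangentSp x) (V : X.left.Opens)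
    (hV : x.pt ∈ V) : ⊤ ≤ (tangentHom v).left ⁻¹ᵁ V :=
  fromSpecStalk_preimage x.pt _ V hV

/-- The rate of change of the parameter along a tangent vector at the origin of `ℂ`. -/
def speed (ξ : TangentSp (origin Unit)) : ℂ :=
  tangentApply ξ ((affProd Unit pointC).left.presheaf.germ ⊤ (origin Unit).pt trivial
    (AffineSpace.coord pointC.left ()))

/-- The coordinate vanishes at the origin, so only its ε-part survives. -/
theorem tangentHom_appTop_coord (ξ : TangentSp (origin Unit)) :
    (tangentHom ξ).left.appTop (AffineSpace.coord pointC.left ()) =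
      specFun (TrivSqZeroExt.inr (speed ξ) : DualNumber ℂ) := by
  refine (appTop_eq_specFun _ _).trans (congrArg specFun ?_)
  refine (pullSec_tangentHom ξ ⊤ trivial le_rfl _).trans ?_
  refine TrivSqZeroExt.ext ?_ rfl
  change (origin Unit).eval _ = 0
  refine ((origin Unit).eval_germ ⊤ trivial _).trans ?_
  have h := pullSec_top (R := CommRingCat.of ℂ) (origin Unit).left
  refine congr($h _).trans ?_
  rw [CommRingCat.comp_apply, origin, slice, appTop_pairing_coord]
  simp

theorem tangentHom_orbit {X : CSch} (σ : OneParamUnipotent X) (ξ : TangentSp (origin Unit))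
    (x : CPoint X) : tangentHom ξ ≫ σ.orbit x =
      act σ.map ((tangentHom ξ ≫ proj Unit pointC) ≫ x)
        (specFun (TrivSqZeroExt.inr (speed ξ) : DualNumber ℂ)) := by
  rw [OneParamUnipotent.orbit, affMap_eq_pairing, ← tangentHom_appTop_coord, Category.assoc]
  exact comp_act σ.map (tangentHom ξ) (proj Unit pointC ≫ x) (AffineSpace.coord pointC.left ())

/-! ### The velocity field of a unipotent group is algebraic -/

/-- The functoriality of the dual numbers. -/
def dualMap {A B : Type} [CommRing A] [CommRing B] (φ : A →+* B) :
    DualNumber A →+* DualNumber B where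
  toFun z := (φ z.fst, φ z.snd)
  map_one' := TrivSqZeroExt.ext (map_one φ) (map_zero φ)
  map_mul' a b := by
    refine TrivSqZeroExt.ext (map_mul φ _ _) ?_
    change φ (a * b).snd = φ a.fst • φ b.snd + MulOpposite.op (φ b.fst) • φ a.snd
    simp
  map_zero' := TrivSqZeroExt.ext (map_zero φ) (map_zero φ)
  map_add' a b := TrivSqZeroExt.ext (map_add φ _ _) (map_add φ _ _)

section velocityField

variable {X : CSch} {V : X.left.Opens}

/-- The structure map of the dual numbers over the sections on `V`. -/
abbrev dualSecConst (V : X.left.Opens) : ℂ →+* DualNumber Γ(X.left, V) :=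
  (TrivSqZeroExt.inlHom Γ(X.left, V) Γ(X.left, V)).comp (algebraMap ℂ Γ(X.left, V))

/-- The inclusion of `V` into `X`, extended to the spectrum of the dual numbers over `V`. -/
def thickIncl (hA : IsAffineOpen V) : specOver (dualSecConst V) ⟶ X :=
  Over.homMk (Spec.map (CommRingCat.ofHom (TrivSqZeroExt.inlHom Γ(X.left, V) Γ(X.left, V))) ≫
    hA.fromSpec) (by
    refine comp_hom_eq_specMap _ fun c => ?_
    have h1 := pullSec_specMap_comp hA.fromSpec
      (CommRingCat.ofHom (TrivSqZeroExt.inlHom Γ(X.left, V) Γ(X.left, V))) ⊤ le_rfl le_rfl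
    rw [← map_pullSec hA.fromSpec le_top (top_le_fromSpec_preimage hA) le_rfl,
      pullSec_fromSpec] at h1
    exact congr($h1 (const X c)))

/-- The infinitesimal flow of `σ` on `V`, with speed `c`. -/
def thickFlow (hA : IsAffineOpen V) (σ : OneParamUnipotent X) (c : ℂ) : specOver (dualSecConst V) ⟶ X :=
  act σ.map (thickIncl hA)
    (specFun (TrivSqZeroExt.inr (algebraMap ℂ Γ(X.left, V) c) : DualNumber Γ(X.left, V)))

/-- Modulo ε the time is zero and the flow is the inclusion of V. Adding nilpotents creates no new
points, so the image stays in V. -/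
theorem top_le_thickFlow_preimage (hA : IsAffineOpen V) (σ : OneParamUnipotent X) (c : ℂ) :
    ⊤ ≤ (thickFlow hA σ c).left ⁻¹ᵁ V := by
  let p : DualNumber Γ(X.left, V) →+* Γ(X.left, V) :=
    (TrivSqZeroExt.fstHom Γ(X.left, V) Γ(X.left, V) Γ(X.left, V)).toRingHom
  let j : specOver (algebraMap ℂ Γ(X.left, V)) ⟶ specOver (dualSecConst V) := specHom p rfl
  have hj : j ≫ thickFlow hA σ c = j ≫ thickIncl hA := by
    have h0 : j.left.appTop (specFun (TrivSqZeroExt.inr (algebraMap ℂ Γ(X.left, V) c))) = 0 :=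
      (appTop_specHom p rfl _).trans (map_zero (Scheme.ΓSpecIso Γ(X.left, V)).inv.hom)
    rw [thickFlow, comp_act, h0, σ.act_zero]
  -- The kernel of p squares to zero, so it lies in every prime.
  have hs : Function.Surjective j.left := by
    have hp : Function.Surjective p := fun a => ⟨TrivSqZeroExt.inl a, rfl⟩
    have : Set.range (PrimeSpectrum.comap p) = Set.univ := by
      rw [range_comap_of_surjective _ p hp, PrimeSpectrum.zeroLocus_eq_univ_iff]
      intro z hz
      refine ⟨2, ?_⟩
      have hz' : z.fst = 0 := hz
      refine TrivSqZeroExt.ext ?_ ?_ <;> simp [pow_two, hz']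
    exact Set.range_eq_univ.1 this
  intro y _
  obtain ⟨y', rfl⟩ := hs y
  have h1 : (j ≫ thickFlow hA σ c).left y' ∈ V := by
    rw [hj]
    have : (j ≫ thickIncl hA).left y' ∈ Set.range hA.fromSpec := ⟨_, rfl⟩
    rwa [hA.range_fromSpec] at this
  exact h1

theorem specMap_evalSec_fromSpec (hA : IsAffineOpen V) (x : CPoint X) (hx : x.pt ∈ V) :
    Spec.map (CommRingCat.ofHom (x.evalSec V hx).toRingHom) ≫ hA.fromSpec = x.left := by
  rw [← specMap_pullSec_fromSpec (R := CommRingCat.of ℂ) hA x.left (x.top_le_preimage V hx)]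
  congr 2
  ext f
  exact x.eval_germ V hx f

/-- The inclusion of the tangent fibre at `x` into the spectrum of the dual numbers over `V`. -/
def thickPoint (x : CPoint X) (hx : x.pt ∈ V) :
    specOver (algebraMap ℂ (DualNumber ℂ)) ⟶ specOver (dualSecConst V) :=
  specHom (dualMap (x.evalSec V hx).toRingHom) (RingHom.ext fun c =>
    TrivSqZeroExt.ext ((x.evalSec V hx).commutes c) (map_zero (x.evalSec V hx)))

theorem thickPoint_thickIncl (hA : IsAffineOpen V) (x : CPoint X) (hx : x.pt ∈ V)
    (q : specOver (algebraMap ℂ (DualNumber ℂ)) ⟶ pointC) :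
    thickPoint x hx ≫ thickIncl hA = q ≫ x := by
  ext : 1
  have h1 : q.left = Spec.map (CommRingCat.ofHom (algebraMap ℂ (DualNumber ℂ))) :=
    (Category.comp_id _).symm.trans (Over.w q)
  change Spec.map _ ≫ Spec.map _ ≫ hA.fromSpec = q.left ≫ x.left
  rw [h1, ← specMap_evalSec_fromSpec hA x hx, ← Category.assoc, ← Spec.map_comp, ← Category.assoc,
    ← Spec.map_comp, ← CommRingCat.ofHom_comp, ← CommRingCat.ofHom_comp]
  have e : (dualMap (x.evalSec V hx).toRingHom).comp
      (TrivSqZeroExt.inlHom Γ(X.left, V) Γ(X.left, V)) =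
      (algebraMap ℂ (DualNumber ℂ)).comp (x.evalSec V hx).toRingHom :=
    RingHom.ext fun f => TrivSqZeroExt.ext rfl (map_zero (x.evalSec V hx))
  rw [e]

/-- Specializing the universal infinitesimal flow at x gives the infinitesimal orbit of x; this
makes the velocities at different points vary algebraically. -/
theorem thickPoint_thickFlow (hA : IsAffineOpen V) (σ : OneParamUnipotent X)
    (ξ : TangentSp (origin Unit)) (x : CPoint X) (hx : x.pt ∈ V) :
    thickPoint x hx ≫ thickFlow hA σ (speed ξ) = tangentHom ξ ≫ σ.orbit x := by
  rw [tangentHom_orbit, ← thickPoint_thickIncl hA x hx, thickFlow, comp_act]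
  refine congrArg (act σ.map _) ((appTop_specHom _ _ _).trans (congrArg specFun ?_))
  exact TrivSqZeroExt.ext (map_zero (x.evalSec V hx)) ((x.evalSec V hx).commutes (speed ξ))

theorem pullSec_comp_eq_of_comp_eq {Y Z : Scheme.{0}} {B C : CommRingCat.{0}} {ψ : B ⟶ C}
    {w : Spec B ⟶ Y} {m : Spec C ⟶ Z} {o : Z ⟶ Y} (e : Spec.map ψ ≫ w = m ≫ o) (V : Y.Opens)
    (hw : ⊤ ≤ w ⁻¹ᵁ V) (hm : ⊤ ≤ m ⁻¹ᵁ (o ⁻¹ᵁ V)) :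
    pullSec w V hw ≫ ψ = o.app V ≫ pullSec m (o ⁻¹ᵁ V) hm := by
  have hE : ⊤ ≤ (Spec.map ψ ≫ w) ⁻¹ᵁ V := fun y _ => hw (Set.mem_univ (Spec.map ψ y))
  have hE' : ⊤ ≤ (m ≫ o) ⁻¹ᵁ V := hm
  rw [← pullSec_specMap_comp w ψ V hw hE, pullSec_congr e V hE hE', pullSec_comp]

theorem exists_velocity_section (hA : IsAffineOpen V) (σ : OneParamUnipotent X)
    (ξ : TangentSp (origin Unit)) (f : Γ(X.left, V)) :
    ∃ h : Γ(X.left, V), ∀ (x : CPoint X) (hx : x.pt ∈ V),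
      tanEval (velocity σ ξ x) V hx f = x.evalSec V hx h := by
  have hw := top_le_thickFlow_preimage hA σ (speed ξ)
  -- The section is the ε-coefficient of f pulled back along the infinitesimal flow; it does not
  -- depend on x.
  refine ⟨TrivSqZeroExt.snd
    (pullSec (thickFlow hA σ (speed ξ)).left V hw f : DualNumber Γ(X.left, V)), fun x hx => ?_⟩
  have hO : (origin Unit).pt ∈ (σ.orbit x).left ⁻¹ᵁ V := by
    change CPoint.pt (origin Unit ≫ σ.orbit x) ∈ V
    rwa [σ.origin_orbit x]
  have hT := top_le_tangentHom_preimage ξ _ hO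
  have h1 := pullSec_comp_eq_of_comp_eq
    (ψ := CommRingCat.ofHom (dualMap (x.evalSec V hx).toRingHom))
    (congrArg (fun g => g.left) (thickPoint_thickFlow hA σ ξ x hx)) V hw hT
  have h4 := (ConcreteCategory.congr_hom h1 f).trans (pullSec_tangentHom ξ _ hO hT _)
  rw [velocity, tanEval_tangentCongr]
  exact (tanEval_differential (σ.orbit x) _ ξ V hO f).trans (congrArg TrivSqZeroExt.snd h4).symm

end velocityField

end

end CAlg

namespace CAlg

/-! ### Finitely many unipotent groups suffice -/

theorem exists_cpoint_pt_eq {X : CSch} [LocallyOfFiniteType X.hom] {z : X.left}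
    (hz : IsClosed {z}) : ∃ x : CPoint X, x.pt = z :=
  ⟨Over.homMk (pointOfClosedPoint X.hom z hz) (pointOfClosedPoint_comp X.hom z hz),
    pointOfClosedPoint_apply X.hom z hz _⟩

theorem CPoint.mem_basicOpen_iff {X : CSch} (x : CPoint X) {V : X.left.Opens} (hV : x.pt ∈ V)
    (g : Γ(X.left, V)) : x.pt ∈ X.left.basicOpen g ↔ x.evalSec V hV g ≠ 0 := by
  rw [Scheme.mem_basicOpen _ _ _ hV]
  refine ⟨fun h => (h.map x.eval).ne_zero, fun h => ?_⟩
  have : IsLocalHom x.eval := Scheme.isLocalHom_stalkClosedPointTo' (R := ℂ) x.left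
  exact isUnit_of_map_unit x.eval _ (isUnit_iff_ne_zero.2 h)

theorem exists_open_finset_span_velocity {X : CSch} [LocallyOfFiniteType X.hom] (x₀ : CPoint X)
    (h : Submodule.span ℂ (orbitTangents x₀) = ⊤) :
    ∃ (W : X.left.Opens) (s : Finset (OneParamUnipotent X)), x₀.pt ∈ W ∧
      ∀ x : CPoint X, x.pt ∈ W →
        Submodule.span ℂ {v | ∃ σ ∈ s, ∃ ξ, v = velocity σ ξ x} = ⊤ := by
  classical
  obtain ⟨V, hA, hV, -⟩ := exists_isAffineOpen_mem_and_subset (U := ⊤) (x := x₀.pt) trivial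
  have := finiteType_sections hA
  choose D hD using fun (p : OneParamUnipotent X × TangentSp (origin Unit)) f =>
    exists_velocity_section hA p.1 p.2 f
  obtain ⟨s, g, hg, hs⟩ := exists_finset_pointDer_le_span (x₀.evalSec V hV) D
    (fun p => tanRes x₀ V hV (velocity p.1 p.2 x₀)) (fun p => tanRes_mem_pointDer _ _ _ _)
    (fun p f => hD p f x₀ hV) (fun d hd => by
      obtain ⟨v, rfl⟩ := exists_tanRes_eq x₀ hA hV hd
      have hv : v ∈ Submodule.span ℂ (orbitTangents x₀) := h ▸ Submodule.mem_top
      have := Submodule.mem_map_of_mem (f := tanRes x₀ V hV) hv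
      rw [Submodule.map_span] at this
      refine Submodule.span_mono ?_ this
      rintro _ ⟨_, ⟨σ, ξ, rfl⟩, rfl⟩
      exact ⟨(σ, ξ), rfl⟩)
  -- The fields are indexed by a subgroup and a parameter velocity. Only the subgroup is kept,
  -- because the span runs over all ξ.
  refine ⟨X.left.basicOpen g, s.image Prod.fst, (x₀.mem_basicOpen_iff hV g).2 hg, fun x hx => ?_⟩
  have hxV : x.pt ∈ V := X.left.basicOpen_le g hx
  refine eq_top_iff.2 fun v _ => ?_
  have hv := hs (x.evalSec V hxV) ((x.mem_basicOpen_iff hxV g).1 hx)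
    (fun p => tanRes x V hxV (velocity p.1 p.2 x)) (fun p _ => tanRes_mem_pointDer _ _ _ _)
    (fun p _ f => hD p f x hxV) (tanRes_mem_pointDer x V hxV v)
  rw [← Function.comp_def (tanRes x V hxV), Set.image_comp, ← Submodule.map_span] at hv
  obtain ⟨v', hv', e⟩ := hv
  rw [← tanRes_injective x hA hxV e]
  refine Submodule.span_mono ?_ hv'
  rintro _ ⟨p, hp, rfl⟩
  exact ⟨p.1, Finset.mem_image_of_mem _ hp, p.2, rfl⟩

theorem exists_finset_span_velocity {X : CSch} [LocallyOfFiniteType X.hom] [CompactSpace X.left]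
    (h : ∀ x : CPoint X, Submodule.span ℂ (orbitTangents x) = ⊤) :
    ∃ s : Finset (OneParamUnipotent X), ∀ x : CPoint X,
      Submodule.span ℂ {v | ∃ σ ∈ s, ∃ ξ, v = velocity σ ξ x} = ⊤ := by
  classical
  choose W s hW hs using fun x : CPoint X => exists_open_finset_span_velocity x (h x)
  -- A nonempty closed complement would contain a closed point, which is a complex point since X is
  -- locally of finite type over ℂ; but each complex point x lies in W x.
  have hcov : (Set.univ : Set X.left) ⊆ ⋃ x, (W x : Set X.left) := by
    by_contra hne
    obtain ⟨y, -, hy⟩ := Set.not_subset.1 hne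
    obtain ⟨z, hz, hzc⟩ := IsClosed.exists_closed_singleton
      (S := (⋃ x, (W x : Set X.left))ᶜ) (isOpen_iUnion fun x => (W x).2).isClosed_compl ⟨y, hy⟩
    obtain ⟨x, rfl⟩ := exists_cpoint_pt_eq hzc
    exact hz (Set.mem_iUnion.2 ⟨x, hW x⟩)
  obtain ⟨t, ht⟩ := isCompact_univ.elim_finite_subcover _ (fun x => (W x).2) hcov
  refine ⟨t.biUnion s, fun x => ?_⟩
  obtain ⟨x₀, hx₀, hx⟩ := Set.mem_iUnion₂.1 (ht (Set.mem_univ x.pt))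
  rw [eq_top_iff, ← hs x₀ x hx]
  refine Submodule.span_mono ?_
  rintro v ⟨σ, hσ, ξ, rfl⟩
  exact ⟨σ, Finset.mem_biUnion.2 ⟨x₀, hx₀, hσ⟩, ξ, rfl⟩

theorem IsFlexible.exists_isDominating_composedSpray {X : CSch} (hX : IsFlexible X) :
    ∃ (N : ℕ) (σ : Fin N → OneParamUnipotent X), IsDominating (composedSpray σ) := by
  have := hX.isAlgebraicManifold.smooth
  have := hX.isAlgebraicManifold.quasiCompact
  have : CompactSpace X.left := (quasiCompact_iff_compactSpace X.hom).1 this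
  obtain ⟨s, hs⟩ := exists_finset_span_velocity hX.span_eq_top
  refine ⟨s.card, fun i => (s.equivFin.symm i).1, isDominating_composedSpray _ fun x => ?_⟩
  rw [eq_top_iff, ← hs x]
  refine Submodule.span_mono ?_
  rintro v ⟨σ, hσ, ξ, rfl⟩
  exact ⟨s.equivFin ⟨σ, hσ⟩, ξ, by simp⟩

end CAlg

/-! ### The proposition. -/

theorem mainTheorem7 (Y : CAlg.CSch) (hY : CAlg.IsAlgebraicManifold Y) :
    (CAlg.IsLocallyFlexible Y → CAlg.HasLocalSpraysWithSmallSing Y) ∧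
    ∀ U : Y.left.Opens, CAlg.IsFlexible (CAlg.opn Y U) →
      ∃ (N : ℕ) (σ : Fin N → CAlg.OneParamUnipotent (CAlg.opn Y U)),
        CAlg.IsSpray (𝟙 (CAlg.opn Y U)) (CAlg.composedSpray σ) ∧
        CAlg.IsDominating (CAlg.composedSpray σ) ∧
        (∀ w : Fin N → ℂ, IsIso (CAlg.slice (CAlg.opn Y U) w ≫ CAlg.composedSpray σ)) ∧
        CAlg.Sing (CAlg.composedSpray σ) = ∅ ∧
        CAlg.IsSpray (CAlg.incl Y U) (CAlg.composedSpray σ ≫ CAlg.incl Y U) ∧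
        CAlg.IsDominating (CAlg.composedSpray σ ≫ CAlg.incl Y U) ∧
        CAlg.Sing (CAlg.composedSpray σ ≫ CAlg.incl Y U) = ∅ := by
  have key (U : Y.left.Opens) (hU : CAlg.IsFlexible (CAlg.opn Y U)) :
      ∃ (N : ℕ) (σ : Fin N → CAlg.OneParamUnipotent (CAlg.opn Y U)),
        CAlg.IsDominating (CAlg.composedSpray σ) ∧
        CAlg.IsSpray (CAlg.incl Y U) (CAlg.composedSpray σ ≫ CAlg.incl Y U) ∧
        CAlg.IsDominating (CAlg.composedSpray σ ≫ CAlg.incl Y U) ∧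
        CAlg.Sing (CAlg.composedSpray σ ≫ CAlg.incl Y U) = ∅ := by
    obtain ⟨N, σ, hσ⟩ := hU.exists_isDominating_composedSpray
    refine ⟨N, σ, hσ, ?_, fun x => ?_, CAlg.sing_eq_empty fun z => ?_⟩
    · rw [CAlg.IsSpray, ← Category.assoc, CAlg.isSpray_composedSpray σ, Category.id_comp]
    · rw [← Category.assoc]
      exact (hσ x).comp (CAlg.isSubmersionAt_incl Y U _)
    · exact (CAlg.isSubmersionAt_composedSpray σ z).comp (CAlg.isSubmersionAt_incl Y U _)
  refine ⟨fun h y => ?_, fun U hU => ?_⟩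
  · obtain ⟨U, hy, hU⟩ := h.cover y
    obtain ⟨N, σ, -, hs, hd, he⟩ := key U hU
    refine ⟨U, hy, N, _, ?_, hs, hd⟩
    have : IsEmpty (TopologicalSpace.IrreducibleCloseds
        (CAlg.Sing (CAlg.composedSpray σ ≫ CAlg.incl Y U))) :=
      ⟨fun Z => by
        obtain ⟨z, -⟩ := Z.isIrreducible.nonempty
        exact (he ▸ z.2 : z.1 ∈ (∅ : Set _))⟩
    -- The empty locus has dimension ⊥, which is below N even when N = 0.
    rw [topologicalKrullDim, Order.krullDim_eq_bot]
    exact WithBot.bot_lt_coe _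
  · obtain ⟨N, σ, hσ, hs, hd, he⟩ := key U hU
    exact ⟨N, σ, CAlg.isSpray_composedSpray σ, hσ, CAlg.isIso_slice_composedSpray σ,
      CAlg.sing_eq_empty (CAlg.isSubmersionAt_composedSpray σ), hs, hd, he⟩
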